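/- Let $\Bbbk$ be an algebraically closed field and let $A$ be a local finite-dimensional associative unital (not necessarily commutative) $\Bbbk$-algebra. Let $DA=\operatorname{Hom}_{\Bbbk}(A,\Bbbk)$ be the $\Bbbk$-dual of $A$ with its $A$-bimodule structure $(af)(x)=f(xa)$, $(fb)(x)=f(bx)$, and let $T(A)=A\ltimes DA$ be the trivial extension of $A$, that is, the algebra with underlying vector space $A\oplus DA$ and multiplication $(a,f)\cdot(b,g)=(ab,\,ag+fb)$. For a $\Bbbk$-algebra $B$ let $\operatorname{HH}_n(B)$ denote its $n$-th Hochschild homology group over $\Bbbk$ with coefficients in $B$, and let $$\operatorname{HHdim} B=\sup\{\,n\ge 0 \mid \operatorname{HH}_n(B)\neq 0\,\}$$ be its Hochschild homology dimension. Then $\operatorname{HHdim} T(A)=\infty$; equivalently, $\operatorname{HH}_n(T(A))\neq 0$ for infinitely many $n$. -/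

import Mathlib

open scoped TensorProduct

/-- The `k`-dual `DA = Hom_k(A, k)` of a `k`-algebra `A`, as a type synonym of `Module.Dual k A` that
carries the `A`-bimodule structure below. -/
def DualBimodule (k A : Type*) [Field k] [Ring A] [Algebra k A] : Type _ :=
  Module.Dual k A

namespace DualBimodule

variable {k A : Type*} [Field k] [Ring A] [Algebra k A]

instance : AddCommGroup (DualBimodule k A) :=
  inferInstanceAs (AddCommGroup (Module.Dual k A))

instance : Module k (DualBimodule k A) :=
  inferInstanceAs (Module k (Module.Dual k A))

/-- A linear form on `A`, seen as an element of the bimodule `DA`. -/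
def of (k A : Type*) [Field k] [Ring A] [Algebra k A] : Module.Dual k A ≃ₗ[k] DualBimodule k A :=
  LinearEquiv.refl k _

/-- An element of `DA` is a function on `A`. -/
instance : CoeFun (DualBimodule k A) (fun _ => A → k) :=
  ⟨fun f => ((of k A).symm f : A →ₗ[k] k)⟩

@[ext]
theorem ext {f g : DualBimodule k A} (h : ∀ x : A, f x = g x) : f = g :=
  LinearMap.ext h

theorem of_apply (f : Module.Dual k A) (x : A) : of k A f x = f x := rfl

theorem add_apply (f g : DualBimodule k A) (x : A) : (f + g) x = f x + g x := rfl

theorem zero_apply (x : A) : (0 : DualBimodule k A) x = 0 := rfl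

theorem smul_apply (c : k) (f : DualBimodule k A) (x : A) : (c • f) x = c * f x := rfl

theorem map_add (f : DualBimodule k A) (x y : A) : f (x + y) = f x + f y :=
  LinearMap.map_add _ x y

theorem map_zero (f : DualBimodule k A) : f 0 = 0 :=
  LinearMap.map_zero _

theorem map_smul (f : DualBimodule k A) (c : k) (x : A) : f (c • x) = c * f x :=
  LinearMap.map_smul _ c x

/-- The left action of `A` on `DA`: `(a f)(x) = f(x a)`. -/
instance : SMul A (DualBimodule k A) :=
  ⟨fun a f => of k A (((of k A).symm f).comp (LinearMap.mulRight k a))⟩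

/-- The right action of `A` on `DA`: `(f a)(x) = f(a x)`. -/
instance : SMul Aᵐᵒᵖ (DualBimodule k A) :=
  ⟨fun a f => of k A (((of k A).symm f).comp (LinearMap.mulLeft k a.unop))⟩

theorem left_smul_apply (a : A) (f : DualBimodule k A) (x : A) : (a • f) x = f (x * a) := rfl

theorem right_smul_apply (a : Aᵐᵒᵖ) (f : DualBimodule k A) (x : A) :
    (a • f) x = f (a.unop * x) := rfl

instance : Module A (DualBimodule k A) where
  one_smul f := by ext x; simp [left_smul_apply]
  mul_smul a b f := by ext x; simp [left_smul_apply, mul_assoc]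
  smul_zero a := by ext x; simp [left_smul_apply]
  smul_add a f g := by ext x; simp [left_smul_apply]
  add_smul a b f := by ext x; simp [left_smul_apply, mul_add, map_add]
  zero_smul f := by ext x; simp [left_smul_apply, map_zero]

instance : Module Aᵐᵒᵖ (DualBimodule k A) where
  one_smul f := by ext x; simp [right_smul_apply]
  mul_smul a b f := by ext x; simp [right_smul_apply, mul_assoc]
  smul_zero a := by ext x; simp [right_smul_apply]
  smul_add a f g := by ext x; simp [right_smul_apply]
  add_smul a b f := by ext x; simp [right_smul_apply, add_mul, map_add]
  zero_smul f := by ext x; simp [right_smul_apply, map_zero]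

instance : SMulCommClass A Aᵐᵒᵖ (DualBimodule k A) :=
  ⟨fun a b f => by ext x; simp [left_smul_apply, right_smul_apply, mul_assoc]⟩

instance : IsScalarTower k A (DualBimodule k A) :=
  ⟨fun c a f => by ext x; simp [left_smul_apply]⟩

instance : IsScalarTower k Aᵐᵒᵖ (DualBimodule k A) :=
  ⟨fun c a f => by ext x; simp [right_smul_apply]⟩

end DualBimodule

/-- The trivial extension `T(A) = A ⋉ DA`: the vector space `A ⊕ DA` with the multiplication
`(a, f) (b, g) = (a b, a g + f b)`. -/
abbrev TrivialExtension (k A : Type*) [Field k] [Ring A] [Algebra k A] : Type _ :=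
  TrivSqZeroExt A (DualBimodule k A)

namespace Hochschild

section Faces

variable {B : Type*}

/-- The faces of the cyclic bar construction on tuples: for `i ≤ n` the `i`-th face is
`(b₀, …, bₙ₊₁) ↦ (b₀, …, bᵢ bᵢ₊₁, …, bₙ₊₁)`, and the last one, `i = n + 1`, is
`(b₀, …, bₙ₊₁) ↦ (bₙ₊₁ b₀, b₁, …, bₙ)`. -/
def face [Mul B] {n : ℕ} (i : Fin (n + 2)) (b : Fin (n + 2) → B) : Fin (n + 1) → B := fun j =>
  if i = Fin.last (n + 1) then
    if j = 0 then b (Fin.last (n + 1)) * b 0 else b j.castSucc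
  else if (j : ℕ) < i then b j.castSucc
  else if (j : ℕ) = i then b j.castSucc * b j.succ
  else b j.succ

/-- The simplicial identities `dᵢ dⱼ₊₁ = dⱼ dᵢ` for `i ≤ j`. -/
theorem face_face [Semigroup B] {n : ℕ} (i j : Fin (n + 2)) (h : i ≤ j)
    (b : Fin (n + 3) → B) : face i (face j.succ b) = face j (face i.castSucc b) := by
  obtain ⟨i, hi⟩ := i
  obtain ⟨j, hj⟩ := j
  funext ⟨m, hm⟩
  simp only [Fin.mk_le_mk] at h
  obtain ⟨c, hc⟩ : ∃ c : ℕ → B, ∀ x : Fin (n + 3), b x = c x :=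
    ⟨fun l => if hl : l < n + 3 then b ⟨l, hl⟩ else b 0, fun x => by simp⟩
  simp only [face, Fin.ext_iff, Fin.val_last, Fin.val_zero, Fin.succ_mk, Fin.castSucc_mk, hc]
  rcases Nat.eq_zero_or_pos m with h0 | h0 <;>
  rcases lt_trichotomy m i with h1 | h1 | h1 <;>
  rcases lt_trichotomy m j with h2 | h2 | h2 <;>
  rcases lt_trichotomy (m + 1) j with h3 | h3 | h3 <;>
  rcases eq_or_ne i (n + 1) with h4 | h4 <;>
  rcases eq_or_ne j (n + 1) with h5 | h5 <;>
  first
    | omega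
    | (simp (disch := omega) only [if_pos, if_neg, mul_assoc]; done)
    | (simp (disch := omega) only [if_pos, if_neg]; subst_vars; simp [mul_assoc])

/-- Changing one entry of a tuple changes one entry of each face, and in a linear way. -/
theorem face_update {k : Type*} [Field k] [Ring B] [Algebra k B] {n : ℕ} (i : Fin (n + 2))
    (b : Fin (n + 2) → B) (p : Fin (n + 2)) :
    ∃ (q : Fin (n + 1)) (g : B →ₗ[k] B), ∀ x : B,
      face i (Function.update b p x) = Function.update (face i b) q (g x) := by
  by_cases hi : i = Fin.last (n + 1)
  · subst hi
    by_cases hp : p = Fin.last (n + 1)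
    · refine ⟨0, LinearMap.mulRight k (b 0), fun x => ?_⟩
      funext j
      simp only [face, Function.update_apply, Fin.ext_iff, hp, Fin.val_last, Fin.val_zero,
        Fin.val_castSucc, LinearMap.mulRight_apply]
      grind
    · obtain ⟨q, rfl⟩ := Fin.exists_castSucc_eq.mpr hp
      refine ⟨q, if q = 0 then LinearMap.mulLeft k (b (Fin.last (n + 1))) else LinearMap.id,
        fun x => ?_⟩
      funext j
      simp only [face, Function.update_apply, Fin.ext_iff, Fin.val_last, Fin.val_zero,
        Fin.val_castSucc]
      split_ifs <;> first | omega | rfl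
  · obtain ⟨l, rfl⟩ := Fin.exists_castSucc_eq.mpr hi
    by_cases hp : p ≤ l.castSucc
    · obtain ⟨q, rfl⟩ : ∃ q : Fin (n + 1), q.castSucc = p :=
        Fin.exists_castSucc_eq.mpr (ne_of_lt (lt_of_le_of_lt hp (Fin.castSucc_lt_last l)))
      rw [Fin.le_def] at hp
      refine ⟨q, if q = l then LinearMap.mulRight k (b l.succ) else LinearMap.id,
        fun x => ?_⟩
      funext j
      simp only [face, Function.update_apply, Fin.ext_iff, Fin.val_last,
        Fin.val_castSucc, Fin.val_succ] at hp ⊢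
      split_ifs <;> first
        | omega
        | rfl
        | (have : j = l := Fin.ext (by omega)
           subst this; rfl)
    · obtain ⟨q, rfl⟩ : ∃ q : Fin (n + 1), q.succ = p :=
        Fin.exists_succ_eq.mpr (by rintro rfl; exact hp (Fin.zero_le _))
      rw [Fin.le_def] at hp
      refine ⟨q, if q = l then LinearMap.mulLeft k (b l.castSucc) else LinearMap.id,
        fun x => ?_⟩
      funext j
      simp only [face, Function.update_apply, Fin.ext_iff, Fin.val_last,
        Fin.val_castSucc, Fin.val_succ] at hp ⊢
      split_ifs <;> first
        | omega
        | rfl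
        | (have : j = l := Fin.ext (by omega)
           subst this; rfl)

end Faces

variable (k B : Type*) [Field k] [Ring B] [Algebra k B]

/-- The space of Hochschild `n`-chains: the tensor power `B ⊗ B ⊗ ⋯ ⊗ B` over `k` with `n + 1`
factors. -/
abbrev Chain (n : ℕ) : Type _ := ⨂[k] _ : Fin (n + 1), B

/-- The `i`-th face map `b₀ ⊗ ⋯ ⊗ bₙ₊₁ ↦ b₀ ⊗ ⋯ ⊗ bᵢ bᵢ₊₁ ⊗ ⋯ ⊗ bₙ₊₁`
(and `b₀ ⊗ ⋯ ⊗ bₙ₊₁ ↦ bₙ₊₁ b₀ ⊗ b₁ ⊗ ⋯ ⊗ bₙ` for `i = n + 1`). -/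
noncomputable def faceMap (n : ℕ) (i : Fin (n + 2)) : Chain k B (n + 1) →ₗ[k] Chain k B n :=
  PiTensorProduct.lift
    { toFun := fun b => PiTensorProduct.tprod k (face i b)
      map_update_add' := by
        intro inst b p x y
        obtain rfl : inst = instDecidableEqFin _ := Subsingleton.elim _ _
        obtain ⟨q, g, h⟩ := face_update (k := k) i b p
        rw [h, h, h, map_add, MultilinearMap.map_update_add]
      map_update_smul' := by
        intro inst b p c x
        obtain rfl : inst = instDecidableEqFin _ := Subsingleton.elim _ _
        obtain ⟨q, g, h⟩ := face_update (k := k) i b p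
        rw [h, h, map_smul, MultilinearMap.map_update_smul] }

theorem faceMap_tprod (n : ℕ) (i : Fin (n + 2)) (b : Fin (n + 2) → B) :
    faceMap k B n i (PiTensorProduct.tprod k b) = PiTensorProduct.tprod k (face i b) :=
  PiTensorProduct.lift.tprod _

/-- The Hochschild differential `∑ᵢ (-1)ⁱ dᵢ` from `(n + 1)`-chains to `n`-chains. -/
noncomputable def differential (n : ℕ) : Chain k B (n + 1) →ₗ[k] Chain k B n :=
  ∑ i : Fin (n + 2), (-1 : k) ^ (i : ℕ) • faceMap k B n i

theorem differential_comp_differential (n : ℕ) :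
    differential k B n ∘ₗ differential k B (n + 1) = 0 := by
  ext b
  simp only [differential, LinearMap.compMultilinearMap_apply, LinearMap.comp_apply,
    LinearMap.sum_apply, LinearMap.smul_apply, map_sum, map_smul, faceMap_tprod, smul_smul,
    Finset.smul_sum, ← Finset.sum_product']
  let S : Finset (Fin (n + 3) × Fin (n + 2)) := {ij | (ij.1 : ℕ) ≤ (ij.2 : ℕ)}
  rw [LinearMap.zero_apply, Finset.univ_product_univ, ← Finset.sum_add_sum_compl S,
    ← eq_neg_iff_add_eq_zero, ← Finset.sum_neg_distrib]
  refine Finset.sum_bij' (fun x hx => (x.2.succ, x.1.castLT (by grind)))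
    (fun x hx => (x.2.castSucc, x.1.pred (by rintro h; simp [S, h] at hx))) ?_ ?_ ?_ ?_ ?_
  · rintro ⟨i, j⟩ hx
    simp only [S, Finset.compl_filter, Finset.mem_filter_univ, Fin.val_succ, Fin.val_castLT]
      at hx ⊢
    omega
  · rintro ⟨i, j⟩ hx
    simp only [S, Finset.compl_filter, Finset.mem_filter_univ, Fin.val_pred, Fin.val_castSucc]
      at hx ⊢
    omega
  · rintro ⟨i, j⟩ hx
    simp
  · rintro ⟨i, j⟩ hx
    simp
  · rintro ⟨i, j⟩ hx
    simp only [S, Finset.mem_filter_univ] at hx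
    obtain ⟨l, rfl⟩ : ∃ l : Fin (n + 2), l.castSucc = i :=
      ⟨i.castLT (by omega), Fin.castSucc_castLT _ _⟩
    simp only [Fin.castLT_castSucc, Fin.val_succ, Fin.val_castSucc]
    rw [face_face l j hx, ← neg_smul]
    congr 1
    ring

/-- The Hochschild `n`-cycles; every `0`-chain is a cycle. -/
noncomputable def cycles : (n : ℕ) → Submodule k (Chain k B n)
  | 0 => ⊤
  | n + 1 => LinearMap.ker (differential k B n)

/-- The Hochschild `n`-boundaries. -/
noncomputable def boundaries (n : ℕ) : Submodule k (Chain k B n) :=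
  LinearMap.range (differential k B n)

theorem boundaries_le_cycles (n : ℕ) : boundaries k B n ≤ cycles k B n := by
  cases n with
  | zero => exact le_top
  | succ n => exact LinearMap.range_le_ker_iff.mpr (differential_comp_differential k B n)

/-- The Hochschild homology `HHₙ(B)` of the `k`-algebra `B` with coefficients in `B`. -/
abbrev HH (n : ℕ) : Type _ :=
  cycles k B n ⧸ (boundaries k B n).submoduleOf (cycles k B n)

/-- The Hochschild homology dimension `HHdim B = sup {n | HHₙ(B) ≠ 0}`. -/
noncomputable def HHdim : ℕ∞ :=
  ⨆ n ∈ {n : ℕ | Nontrivial (HH k B n)}, (n : ℕ∞)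

end Hochschild

/-! The last nonzero power of the radical of `A` contains some `s ≠ 0` with `a s = s a = ε(a) s`,
where `ε(a)` is a scalar. Evaluation at `s` on the `DA` component is then a functional `φ` on `T(A)`
with `φ(xy) = ε(x) φ(y) + φ(x) ε(y)`. Choose `f` with `f(s) ≠ 0` and put `x = (0, f)`. Since `x² =
0`, every face kills `x ⊗ ⋯ ⊗ x`, which is therefore a cycle. In even degree `φ ⊗ ⋯ ⊗ φ` vanishes on
boundaries, by a cyclic telescoping sum (`lift_prod_differential`), yet takes the value `φ(x)^(n+1)
≠ 0` on this cycle. So no even homology group is zero. -/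

/-- A finite-dimensional local algebra over an algebraically closed field has a nonzero element on
which it acts from both sides through scalars. -/
theorem exists_socle_element (k A : Type*) [Field k] [IsAlgClosed k] [Ring A] [Algebra k A]
    [FiniteDimensional k A] [IsLocalRing A] :
    ∃ (s : A) (ε : A → k), s ≠ 0 ∧ ∀ a : A, a * s = ε a • s ∧ s * a = ε a • s := by
  have : IsArtinianRing A := IsArtinianRing.of_finite k A
  have hjac : ∀ a : A, ¬ IsUnit a → a ∈ Ring.jacobson A := by
    intro a ha
    rw [← Ideal.jacobson_bot, Ideal.mem_jacobson_iff]
    intro y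
    -- One-sided inverses in a finite-dimensional algebra are two-sided, so a unit `y * a` would
    -- make `a` a unit.
    have hya : ¬ IsUnit (-(y * a)) := by
      rw [IsUnit.neg_iff]
      exact fun h => ha (isUnit_of_mul_isUnit_right h)
    have h1 : IsUnit (y * a + 1) :=
      (IsLocalRing.isUnit_or_isUnit_of_add_one (a := -(y * a)) (b := y * a + 1)
        (by abel)).resolve_left hya
    obtain ⟨u, hu⟩ := h1
    refine ⟨↑u⁻¹, ?_⟩
    have h2 : (↑u⁻¹ : A) * (y * a + 1) = 1 := by rw [← hu, Units.inv_mul]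
    rw [Ideal.mem_bot, mul_assoc, ← mul_add_one, h2, sub_self]
  have hnil : IsNilpotent (Ring.jacobson A) := IsSemiprimaryRing.isNilpotent
  -- Here `n = 0` is possible: it is the case of zero radical.
  obtain ⟨n, hn, hn'⟩ : ∃ n, Ring.jacobson A ^ n ≠ ⊥ ∧ Ring.jacobson A ^ (n + 1) = ⊥ := by
    classical
    have h0 : Nat.find hnil ≠ 0 := by
      intro h
      have h1 := Nat.find_spec hnil
      rw [h, Submodule.pow_zero, Ideal.one_eq_top] at h1
      exact top_ne_bot h1
    obtain ⟨m, hm⟩ := Nat.exists_eq_succ_of_ne_zero h0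
    exact ⟨m, Nat.find_min hnil (by omega), by
      have := Nat.find_spec hnil
      rwa [hm] at this⟩
  obtain ⟨s, hs, hs0⟩ := Submodule.exists_mem_ne_zero_of_ne_bot hn
  have hspec : ∀ a : A, ∃ c : k, a * s = c • s ∧ s * a = c • s := by
    intro a
    -- For `c` in the spectrum of `a`, the nonunit `a - c` lies in the radical and so kills `s` on
    -- both sides.
    obtain ⟨c, hc⟩ := spectrum.nonempty_of_isAlgClosed_of_finiteDimensional k a
    have hmem := hjac _ (fun h => hc ((IsUnit.sub_iff).mp h))
    have hl : (a - algebraMap k A c) * s = 0 := by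
      rw [← Ideal.mem_bot, ← hn', Ideal.IsTwoSided.pow_succ]
      exact Ideal.mul_mem_mul hmem hs
    have hr : s * (a - algebraMap k A c) = 0 := by
      rw [← Ideal.mem_bot, ← hn', Submodule.pow_succ]
      exact Ideal.mul_mem_mul hs hmem
    rw [sub_mul, sub_eq_zero, ← Algebra.smul_def] at hl
    rw [mul_sub, sub_eq_zero, ← Algebra.commutes, ← Algebra.smul_def] at hr
    exact ⟨c, hl, hr⟩
  choose ε hε using hspec
  exact ⟨s, ε, hs0, hε⟩

namespace Hochschild

/-- The product of the values of an `ε`-derivation `φ` on the entries of the `i`-th face, where the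
faces are indexed cyclically. -/
theorem prod_face_eq {B R : Type*} [Mul B] [CommRing R] (φ ε : B → R)
    (hφ : ∀ x y, φ (x * y) = ε x * φ y + φ x * ε y) {n : ℕ} (i : Fin (n + 2))
    (b : Fin (n + 2) → B) :
    ∏ j, φ (face i b j) =
      ε (b i) * ∏ j : Fin (n + 1), φ (b (i.succAbove j)) +
        ε (b (i + 1)) * ∏ j : Fin (n + 1), φ (b ((i + 1).succAbove j)) := by
  by_cases hi : i = Fin.last (n + 1)
  · subst hi
    -- The last face multiplies the last entry by the first, and `i + 1` wraps around to `0`.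
    rw [Fin.last_add_one, Fin.prod_univ_succ fun j => φ (face _ b j),
      Fin.prod_univ_succ fun j => φ (b ((Fin.last (n + 1)).succAbove j)),
      Fin.prod_univ_castSucc fun j => φ (b ((0 : Fin (n + 2)).succAbove j))]
    simp only [face, if_true, Fin.succ_ne_zero, if_false, hφ, Fin.succAbove_last,
      Fin.succAbove_zero, Fin.castSucc_zero, Fin.succ_last, Fin.succ_castSucc]
    ring
  · obtain ⟨l, rfl⟩ := Fin.exists_castSucc_eq.mpr hi
    -- Away from the merged slot, the face consists of the entries other than `l` and `l + 1`; these
    -- can be listed by omitting either of the two first.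
    have hface : ∀ j, face l.castSucc b (l.succAbove j) =
        b (l.castSucc.succAbove (l.succAbove j)) ∧
        face l.castSucc b (l.succAbove j) = b (l.succ.succAbove (l.succAbove j)) := by
      intro j
      rcases lt_or_ge j.castSucc l with h | h
      · rw [Fin.succAbove_of_castSucc_lt _ _ h]
        simp only [face, if_neg hi, Fin.succAbove, Fin.lt_def, Fin.val_castSucc, Fin.val_succ]
          at h ⊢
        grind
      · rw [Fin.succAbove_of_le_castSucc _ _ h]
        simp only [face, if_neg hi, Fin.succAbove, Fin.lt_def, Fin.le_def, Fin.val_castSucc,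
          Fin.val_succ] at h ⊢
        grind
    have hl : face l.castSucc b l = b l.castSucc * b l.succ := by simp [face, hi]
    rw [Fin.coeSucc_eq_succ, Fin.prod_univ_succAbove (fun j => φ (face _ b j)) l,
      Fin.prod_univ_succAbove (fun j => φ (b (l.castSucc.succAbove j))) l,
      Fin.prod_univ_succAbove (fun j => φ (b (l.succ.succAbove j))) l, hl, hφ,
      Fin.succAbove_castSucc_self, Fin.succAbove_succ_self]
    simp only [← (hface _).1]
    simp only [(hface _).2]
    ring

/-- An even tensor power of an `ε`-derivation with scalar values vanishes on Hochschild
boundaries. -/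
theorem lift_prod_differential (k B : Type*) [Field k] [Ring B] [Algebra k B]
    (φ : B →ₗ[k] k) (ε : B → k) (hφ : ∀ x y, φ (x * y) = ε x * φ y + φ x * ε y)
    {n : ℕ} (hn : Even n) (z : Chain k B (n + 1)) :
    PiTensorProduct.lift ((MultilinearMap.mkPiAlgebra k (Fin (n + 1)) k).compLinearMap
      fun _ => φ) (differential k B n z) = 0 := by
  rw [← LinearMap.comp_apply]
  convert LinearMap.zero_apply z using 2
  ext b
  set E : Fin (n + 2) → k := fun i => ε (b i) * ∏ j : Fin (n + 1), φ (b (i.succAbove j))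
  have hE : ∀ i, ∏ j, φ (face i b j) = E i + E (i + 1) := fun i => prod_face_eq φ ε hφ i b
  simp only [LinearMap.compMultilinearMap_apply, LinearMap.comp_apply, differential,
    LinearMap.sum_apply, LinearMap.smul_apply, map_sum, map_smul, faceMap_tprod,
    PiTensorProduct.lift.tprod, MultilinearMap.compLinearMap_apply,
    MultilinearMap.mkPiAlgebra_apply, hE, LinearMap.zero_apply, smul_eq_mul, mul_add,
    Finset.sum_add_distrib]
  -- The shifted sums cancel except for `E 0` and `(-1)^(n+1) E (last + 1)`. As `last + 1 = 0` and
  -- `n` is even, these cancel too.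
  rw [Fin.sum_univ_succ,
    Fin.sum_univ_castSucc fun i : Fin (n + 2) => (-1 : k) ^ (i : ℕ) * E (i + 1)]
  simp [Fin.coeSucc_eq_succ, pow_succ, hn.neg_one_pow]

/-- If a scalar `ε`-derivation is nonzero on some element of square zero, then the Hochschild homology
is nonzero in every even degree. -/
theorem nontrivial_HH_of_derivation (k B : Type*) [Field k] [Ring B] [Algebra k B]
    (φ : B →ₗ[k] k) (ε : B → k) (hφ : ∀ x y, φ (x * y) = ε x * φ y + φ x * ε y)
    (x : B) (hx : x * x = 0) (hx1 : φ x ≠ 0) {n : ℕ} (hn : Even n) :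
    Nontrivial (HH k B n) := by
  set z : Chain k B n := PiTensorProduct.tprod k fun _ => x
  have hz : z ∈ cycles k B n := by
    cases n with
    | zero => exact Submodule.mem_top
    | succ n =>
      change differential k B n z = 0
      rw [differential, LinearMap.sum_apply]
      refine Finset.sum_eq_zero fun i _ => ?_
      rw [LinearMap.smul_apply, faceMap_tprod]
      -- Each face, the cyclic one included, has an entry `x * x = 0`.
      obtain ⟨j, hj⟩ : ∃ j, face i (fun _ => x) j = 0 := by
        by_cases hi : i = Fin.last (n + 1)
        · exact ⟨0, by simp [face, hi, hx]⟩
        · obtain ⟨l, rfl⟩ := Fin.exists_castSucc_eq.mpr hi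
          exact ⟨l, by simp [face, hi, hx]⟩
      rw [MultilinearMap.map_coord_zero _ j hj, smul_zero]
  rw [Submodule.Quotient.nontrivial_iff]
  intro htop
  have hmem : (⟨z, hz⟩ : cycles k B n) ∈ (boundaries k B n).submoduleOf (cycles k B n) :=
    htop ▸ Submodule.mem_top
  obtain ⟨y, hy⟩ := (show z ∈ boundaries k B n from hmem)
  have h0 := lift_prod_differential k B φ ε hφ hn y
  rw [hy] at h0
  simp [z, hx1] at h0

end Hochschild

theorem mainTheorem1 (k A : Type*) [Field k] [IsAlgClosed k] [Ring A] [Algebra k A]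
    [FiniteDimensional k A] [IsLocalRing A] :
    Hochschild.HHdim k (TrivialExtension k A) = ⊤ := by
  obtain ⟨s, ε, hs, hε⟩ := exists_socle_element k A
  obtain ⟨f, hf⟩ : ∃ f : Module.Dual k A, f s ≠ 0 := by
    by_contra! h
    exact hs ((Module.forall_dual_apply_eq_zero_iff k s).mp h)
  let φ : TrivialExtension k A →ₗ[k] k :=
    { toFun := fun x => x.snd s
      map_add' := fun x y => rfl
      map_smul' := fun c x => rfl }
  -- The two bimodule actions evaluate `DA` at `s * a` and `a * s`, both equal to `ε a • s`.
  have hφ : ∀ x y, φ (x * y) = ε x.fst * φ y + φ x * ε y.fst := by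
    intro x y
    change (x * y).snd s = ε x.fst * y.snd s + x.snd s * ε y.fst
    rw [TrivSqZeroExt.snd_mul, DualBimodule.add_apply, DualBimodule.left_smul_apply,
      DualBimodule.right_smul_apply, MulOpposite.unop_op, (hε _).1, (hε _).2,
      DualBimodule.map_smul, DualBimodule.map_smul, mul_comm (ε y.fst)]
  have hHH : ∀ n, Even n → Nontrivial (Hochschild.HH k (TrivialExtension k A) n) :=
    fun n hn => Hochschild.nontrivial_HH_of_derivation k _ φ _ hφ
      (TrivSqZeroExt.inr (DualBimodule.of k A f)) (TrivSqZeroExt.inr_mul_inr _ _ _) hf hn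
  refine ENat.eq_top_iff_forall_ge.mpr fun m => ?_
  calc (m : ℕ∞) ≤ (2 * m : ℕ) := by exact_mod_cast (by omega)
    _ ≤ _ := le_iSup₂_of_le (2 * m) (hHH _ (even_two_mul m)) le_rfl
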